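/- Let $\mathbb K$ be $\mathbb R$ or $\mathbb C$, let $m\ge 1$, let $\widetilde U\subseteq\mathbb K\times\mathbb K^m$ be open, let $q:\widetilde U\to\mathbb K^m$ be analytic, and let $(t^*,z^*)\in\widetilde U$ with $q(t^*,z^*)\neq 0$. Then near $(t^*,z^*)$ there are analytic local coordinates $t,x_1,\ldots,x_m$ in which the non-autonomous system $\dot z=q(t,z)$ takes the form $$\dot x_j=x_{j+1}\quad(1\le j\le m-1),\qquad \dot x_m=p(t,x_1,\ldots,x_m).$$ Precisely, there are an open neighbourhood $W\subseteq\widetilde U$ of $(t^*,z^*)$, an open set $W'\subseteq\mathbb K\times\mathbb K^m$, an analytic bijection $\Phi:W\to W'$ with analytic inverse that preserves the variable $t$, that is, $\Phi(t,z)=(t,x(t,z))$, and an analytic function $p:W'\to\mathbb K$ such that $$D\Phi(t,z)\,(1,q(t,z))=\bigl(1,\,x_2,\ldots,x_m,\,p(t,x)\bigr)\quad\text{with }x=x(t,z),\ \text{for all }(t,z)\in W .$$ Hence, for every open $I\subseteq\mathbb K$, a curve $z$ with graph over $I$ in $W$ solves $\dot z=q(t,z)$ on $I$ if and only if $t\mapsto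 x(t,z(t))$ solves the displayed system on $I$. Moreover the system is equivalent on $W$ to the single equation of order $m$ $$y^{(m)}=p\bigl(t,y,\dot y,\ldots,y^{(m-1)}\bigr)\quad\text{on }W':$$ if $z$ solves $\dot z=q(t,z)$ on $I$ with graph in $W$, then $y(t):=x_1(t,z(t))$ solves this equation on $I$ and $\Phi(t,z(t))=(t,y(t),\dot y(t),\ldots,y^{(m-1)}(t))$ for $t \in I$; conversely, if $y$ solves this equation on $I$ (with $(t,y(t),\ldots,y^{(m-1)}(t))\in W'$ for $t\in I$), then $\Phi^{-1}(t,y(t),\ldots,y^{(m-1)}(t))=(t,z(t))$ with $z$ a solution of $\dot z=q(t,z)$ on $I$ with graph in $W$, so the two assignments are mutually inverse. -/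

import Mathlib

/-- The curve `z` solves the first-order system `ż = q(t, z)`, posed on `V ⊆ 𝕂 × 𝕂ᵐ`, on the
(open) time domain `I ⊆ 𝕂`: its graph stays in `V` and it satisfies the equation. -/
def IsSystemSolutionOn {𝕂 : Type*} [RCLike 𝕂] {m : ℕ} (V : Set (𝕂 × (Fin m → 𝕂)))
    (q : 𝕂 × (Fin m → 𝕂) → (Fin m → 𝕂)) (I : Set 𝕂) (z : 𝕂 → (Fin m → 𝕂)) : Prop :=
  ∀ t ∈ I, (t, z t) ∈ V ∧ HasDerivAt z (q (t, z t)) t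

/-- The right-hand side `(x₂, …, xₘ, p(t, x₁, …, xₘ))` of the companion system
`ẋⱼ = xⱼ₊₁` (`1 ≤ j ≤ m - 1`), `ẋₘ = p(t, x)`; the coordinates are indexed from `0` here. -/
def companionField {𝕂 : Type*} [RCLike 𝕂] {m : ℕ} (p : 𝕂 × (Fin m → 𝕂) → 𝕂) :
    𝕂 × (Fin m → 𝕂) → (Fin m → 𝕂) :=
  fun w j => if h : (j : ℕ) + 1 < m then w.2 ⟨(j : ℕ) + 1, h⟩ else p w

/-- The tuple `(y(t), ẏ(t), …, y⁽ᵐ⁻¹⁾(t))`. -/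
noncomputable def jetTuple {𝕂 : Type*} [RCLike 𝕂] (m : ℕ) (y : 𝕂 → 𝕂) (t : 𝕂) : Fin m → 𝕂 :=
  fun k => iteratedDeriv (k : ℕ) y t

/-- The function `y` solves the single equation `y⁽ᵐ⁾ = p(t, y, ẏ, …, y⁽ᵐ⁻¹⁾)`, posed on
`V ⊆ 𝕂 × 𝕂ᵐ`, on the (open) time domain `I ⊆ 𝕂`; in particular it is `m` times differentiable
there. -/
def IsScalarSolutionOn {𝕂 : Type*} [RCLike 𝕂] {m : ℕ} (V : Set (𝕂 × (Fin m → 𝕂)))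
    (p : 𝕂 × (Fin m → 𝕂) → 𝕂) (I : Set 𝕂) (y : 𝕂 → 𝕂) : Prop :=
  ∀ t ∈ I, (t, jetTuple m y t) ∈ V ∧
    (∀ k < m, DifferentiableAt 𝕂 (iteratedDeriv k y) t) ∧
    iteratedDeriv m y t = p (t, jetTuple m y t)

/-! Write L for the derivative along `(1, q)`. In companion coordinates each coordinate is L of the
preceding one, so everything is determined by one function h: x = (h, Lh, …, L^(m-1) h) and p = L^m
h. It remains to choose h so that (t, x) are coordinates. Since L t = 1, adding (t - t*)^n g to h
leaves L^j h unchanged on the slice t = t* for j < n and changes L^n h there by n! g. Thus L^j h can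
be prescribed on the slice order by order, and `exists_iterate_timeLieDeriv_eq_coord` makes it the
j-th coordinate of z. Then (t, z) ↦ (t, x) preserves t and is the identity on the slice, so its
derivative at the point is invertible and the analytic inverse function theorem applies. Solutions
are transported by the chain rule. -/

/-- The derivative `∂ₜ f + ∂_z f · q` of `f` along the vector field `(1, q)`. -/
noncomputable def timeLieDeriv {𝕂 : Type*} [RCLike 𝕂] {m : ℕ}
    (q : 𝕂 × (Fin m → 𝕂) → (Fin m → 𝕂)) (f : 𝕂 × (Fin m → 𝕂) → 𝕂) :
    𝕂 × (Fin m → 𝕂) → 𝕂 :=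
  fun w => fderiv 𝕂 f w (1, q w)

/-! ### Derivatives along `(1, q)` and the generating function h. -/

section TimeLieDeriv

variable {𝕂 : Type*} [RCLike 𝕂] {m : ℕ} {U : Set (𝕂 × (Fin m → 𝕂))}
  {q : 𝕂 × (Fin m → 𝕂) → (Fin m → 𝕂)} {f g : 𝕂 × (Fin m → 𝕂) → 𝕂}

theorem AnalyticOnNhd.timeLieDeriv (hq : AnalyticOnNhd 𝕂 q U) (hf : AnalyticOnNhd 𝕂 f U) :
    AnalyticOnNhd 𝕂 (timeLieDeriv q f) U := fun w hw =>
  ((ContinuousLinearMap.id 𝕂 (𝕂 × (Fin m → 𝕂) →L[𝕂] 𝕂)).analyticAt_bilinear _).comp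
    ((hf.fderiv w hw).prod (analyticAt_const.prod (hq w hw)))

theorem AnalyticOnNhd.iterate_timeLieDeriv (hq : AnalyticOnNhd 𝕂 q U)
    (hf : AnalyticOnNhd 𝕂 f U) (n : ℕ) :
    AnalyticOnNhd 𝕂 ((_root_.timeLieDeriv q)^[n] f) U := by
  induction n with
  | zero => exact hf
  | succ n ih => rw [Function.iterate_succ_apply']; exact hq.timeLieDeriv ih

theorem timeLieDeriv_congr (hU : IsOpen U) (h : Set.EqOn f g U) :
    Set.EqOn (timeLieDeriv q f) (timeLieDeriv q g) U := by
  intro w hw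
  have : f =ᶠ[nhds w] g := Filter.eventuallyEq_of_mem (hU.mem_nhds hw) h
  simp only [timeLieDeriv, this.fderiv_eq]

theorem timeLieDeriv_add {w : 𝕂 × (Fin m → 𝕂)} (hf : DifferentiableAt 𝕂 f w)
    (hg : DifferentiableAt 𝕂 g w) :
    timeLieDeriv q (f + g) w = timeLieDeriv q f w + timeLieDeriv q g w := by
  simp [timeLieDeriv, fderiv_add hf hg]

theorem timeLieDeriv_mul {w : 𝕂 × (Fin m → 𝕂)} (hf : DifferentiableAt 𝕂 f w)
    (hg : DifferentiableAt 𝕂 g w) :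
    timeLieDeriv q (f * g) w = f w * timeLieDeriv q g w + g w * timeLieDeriv q f w := by
  simp [timeLieDeriv, fderiv_mul hf hg]

theorem analyticOnNhd_time_sub_pow (c : 𝕂) (n : ℕ) :
    AnalyticOnNhd 𝕂 (fun w : 𝕂 × (Fin m → 𝕂) => (w.1 - c) ^ n) U := fun _ _ =>
  (analyticAt_fst.sub analyticAt_const).pow n

theorem timeLieDeriv_time_sub_pow (c : 𝕂) (n : ℕ) (w : 𝕂 × (Fin m → 𝕂)) :
    timeLieDeriv q (fun w => (w.1 - c) ^ (n + 1)) w = (n + 1) * (w.1 - c) ^ n := by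
  have h : HasFDerivAt (fun w : 𝕂 × (Fin m → 𝕂) => (w.1 - c) ^ (n + 1)) _ w :=
    ((ContinuousLinearMap.fst 𝕂 𝕂 (Fin m → 𝕂)).hasFDerivAt.sub_const c).pow (n + 1)
  simp [timeLieDeriv, h.fderiv]

theorem iterate_timeLieDeriv_add (hU : IsOpen U) (hq : AnalyticOnNhd 𝕂 q U)
    (hf : AnalyticOnNhd 𝕂 f U) (hg : AnalyticOnNhd 𝕂 g U) (n : ℕ) :
    Set.EqOn ((timeLieDeriv q)^[n] (f + g))
      ((timeLieDeriv q)^[n] f + (timeLieDeriv q)^[n] g) U := by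
  induction n with
  | zero => exact fun _ _ => rfl
  | succ n ih =>
    simp only [Function.iterate_succ_apply']
    intro w hw
    rw [timeLieDeriv_congr hU ih hw, timeLieDeriv_add
      (hq.iterate_timeLieDeriv hf n w hw).differentiableAt
      (hq.iterate_timeLieDeriv hg n w hw).differentiableAt]
    rfl

/-- Deriving `(t - c)ʲ⁺ᵏ g` along `(1, q)` lowers the order of vanishing at `t = c` by one each
time, with an explicit leading coefficient. -/
theorem iterate_timeLieDeriv_time_sub_pow_mul (hU : IsOpen U) (hq : AnalyticOnNhd 𝕂 q U)
    (hg : AnalyticOnNhd 𝕂 g U) (c : 𝕂) (j k : ℕ) :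
    ∃ G : 𝕂 × (Fin m → 𝕂) → 𝕂, AnalyticOnNhd 𝕂 G U ∧
      Set.EqOn ((timeLieDeriv q)^[j] ((fun w => (w.1 - c) ^ (j + k)) * g))
        ((fun w => (w.1 - c) ^ k) * (fun w => ((j + k).descFactorial j : 𝕂) * g w) +
          (fun w => (w.1 - c) ^ (k + 1)) * G) U := by
  induction j generalizing k with
  | zero => exact ⟨0, analyticOnNhd_const, fun w _ => by simp⟩
  | succ j ih =>
    obtain ⟨G, hG, hE⟩ := ih (k + 1)
    have hg' : AnalyticOnNhd 𝕂 (fun w => ((j + (k + 1)).descFactorial j : 𝕂) * g w) U :=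
      analyticOnNhd_const.mul hg
    -- By the product rule, these are the terms still divisible by `(t - c) ^ (k + 1)`; the only
    -- other term differentiates the power in front of `g`.
    refine ⟨timeLieDeriv q (fun w => ((j + (k + 1)).descFactorial j : 𝕂) * g w) +
        (fun w => ((k : 𝕂) + 2) * G w) + (fun w => (w.1 - c) ^ 1) * timeLieDeriv q G,
      ((hq.timeLieDeriv hg').add (analyticOnNhd_const.mul hG)).add
        ((analyticOnNhd_time_sub_pow c 1).mul (hq.timeLieDeriv hG)), fun w hw => ?_⟩
    have hpow (n : ℕ) : DifferentiableAt 𝕂 (fun w : 𝕂 × (Fin m → 𝕂) => (w.1 - c) ^ n) w :=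
      (analyticOnNhd_time_sub_pow (U := U) c n w hw).differentiableAt
    have hgd := (hg' w hw).differentiableAt
    have hGd := (hG w hw).differentiableAt
    rw [Function.iterate_succ_apply', show j + 1 + k = j + (k + 1) by ring,
      timeLieDeriv_congr hU hE hw, timeLieDeriv_add ((hpow _).mul hgd) ((hpow _).mul hGd),
      timeLieDeriv_mul (hpow _) hgd, timeLieDeriv_mul (hpow _) hGd,
      timeLieDeriv_time_sub_pow, timeLieDeriv_time_sub_pow]
    have hfac : ((j + (k + 1)).descFactorial (j + 1) : 𝕂) =
        (k + 1) * (j + (k + 1)).descFactorial j := by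
      rw [Nat.descFactorial_succ, show j + (k + 1) - j = k + 1 by omega]
      push_cast; ring
    simp only [Pi.add_apply, Pi.mul_apply, hfac]
    push_cast
    ring

/-- There is an analytic function whose first `n` derivatives along `(1, q)` restrict to the
coordinate functions on the slice `t = c`. -/
theorem exists_iterate_timeLieDeriv_eq_coord (hU : IsOpen U) (hq : AnalyticOnNhd 𝕂 q U) (c : 𝕂)
    (n : ℕ) (hn : n ≤ m) :
    ∃ f : 𝕂 × (Fin m → 𝕂) → 𝕂, AnalyticOnNhd 𝕂 f U ∧
      ∀ j : Fin m, (j : ℕ) < n → ∀ z, (c, z) ∈ U → (timeLieDeriv q)^[j] f (c, z) = z j := by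
  induction n with
  | zero => exact ⟨0, analyticOnNhd_const, fun j hj => absurd hj (Nat.not_lt_zero _)⟩
  | succ n ih =>
    obtain ⟨f, hf, hfc⟩ := ih (by omega)
    -- The error of `f` at order `n`, divided by the factor `n!` that `n` derivatives of `(t - c) ^
    -- n` produce.
    set g : 𝕂 × (Fin m → 𝕂) → 𝕂 :=
      fun w => (n.factorial : 𝕂)⁻¹ * (w.2 ⟨n, hn⟩ - (timeLieDeriv q)^[n] f w) with hgdef
    have hcoord : AnalyticOnNhd 𝕂 (fun w : 𝕂 × (Fin m → 𝕂) => w.2 ⟨n, hn⟩) U := fun w _ =>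
      ((ContinuousLinearMap.proj (R := 𝕂) (φ := fun _ : Fin m => 𝕂) ⟨n, hn⟩).comp
        (ContinuousLinearMap.snd 𝕂 𝕂 (Fin m → 𝕂))).analyticAt w
    have hg : AnalyticOnNhd 𝕂 g U :=
      analyticOnNhd_const.mul (hcoord.sub (hq.iterate_timeLieDeriv hf n))
    have hpg : AnalyticOnNhd 𝕂 ((fun w : 𝕂 × (Fin m → 𝕂) => (w.1 - c) ^ n) * g) U :=
      (analyticOnNhd_time_sub_pow c n).mul hg
    refine ⟨f + (fun w => (w.1 - c) ^ n) * g, hf.add hpg, fun j hj z hz => ?_⟩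
    rw [iterate_timeLieDeriv_add hU hq hf hpg j hz, Pi.add_apply]
    obtain ⟨k, hk⟩ := Nat.exists_eq_add_of_le (Nat.lt_succ_iff.mp hj)
    obtain ⟨G, -, hE⟩ := iterate_timeLieDeriv_time_sub_pow_mul hU hq hg c j k
    rw [← hk] at hE
    rw [hE hz]
    -- `k = n - j` powers of `t - c` survive: for `k = 0` the correction is exactly the error, for
    -- `k > 0` it vanishes on the slice.
    rcases Nat.eq_zero_or_pos k with rfl | hpos
    · obtain rfl : j = ⟨n, hn⟩ := Fin.ext (by simpa using hk.symm)
      have : (n.factorial : 𝕂) ≠ 0 := Nat.cast_ne_zero.mpr n.factorial_ne_zero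
      simp [hgdef, Nat.descFactorial_self, mul_inv_cancel_left₀ this]
    · rw [hfc j (by omega) z hz]
      simp [hpos.ne']

end TimeLieDeriv

/-! ### Local invertibility. -/

/-- The analytic inverse function theorem, on a source where the derivative stays invertible. -/
theorem AnalyticOnNhd.exists_openPartialHomeomorph {𝕂 E F : Type*} [RCLike 𝕂]
    [NormedAddCommGroup E] [NormedSpace 𝕂 E] [CompleteSpace E]
    [NormedAddCommGroup F] [NormedSpace 𝕂 F] [CompleteSpace F] {U : Set E} (hU : IsOpen U)
    {f : E → F} (hf : AnalyticOnNhd 𝕂 f U) {a : E} (ha : a ∈ U) {e : E ≃L[𝕂] F}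
    (he : fderiv 𝕂 f a = e) :
    ∃ Φ : OpenPartialHomeomorph E F, ⇑Φ = f ∧ a ∈ Φ.source ∧ Φ.source ⊆ U ∧
      AnalyticOnNhd 𝕂 Φ.symm Φ.target := by
  have hstrict : HasStrictFDerivAt f (e : E →L[𝕂] F) a := he ▸ (hf a ha).hasStrictFDerivAt
  -- Invertibility of the derivative is an open condition; shrinking to it makes the inverse
  -- analytic on the whole target, not only at `f a`.
  set V : Set E := U ∩ fderiv 𝕂 f ⁻¹' Set.range ((↑) : (E ≃L[𝕂] F) → E →L[𝕂] F)
  have hV : IsOpen V := hf.fderiv.continuousOn.isOpen_inter_preimage hU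
    (ContinuousLinearEquiv.isOpen (𝕜 := 𝕂) (E := E) (F := F))
  let Φ := (hstrict.toOpenPartialHomeomorph f).restrOpen V hV
  refine ⟨Φ, rfl, ⟨hstrict.mem_toOpenPartialHomeomorph_source, ha, e, he.symm⟩,
    fun w hw => hw.2.1, fun w hw => ?_⟩
  have hw' := Φ.map_target hw
  obtain ⟨i, hi⟩ := hw'.2.2
  exact Φ.analyticAt_symm hw (hf _ hw'.2.1) hi.symm

/-- A linear endomorphism of `𝕂 × M` which preserves the first coordinate and is the identity on
`0 × M` is invertible. -/
theorem ContinuousLinearMap.exists_equiv_of_fst_eq {𝕂 M : Type*} [RCLike 𝕂]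
    [NormedAddCommGroup M] [NormedSpace 𝕂 M] [FiniteDimensional 𝕂 M]
    (D : 𝕂 × M →L[𝕂] 𝕂 × M) (hfst : ∀ v, (D v).1 = v.1) (hsnd : ∀ u : M, D (0, u) = (0, u)) :
    ∃ e : (𝕂 × M) ≃L[𝕂] 𝕂 × M, D = e := by
  have hinj : Function.Injective (D : 𝕂 × M →ₗ[𝕂] 𝕂 × M) := by
    refine (injective_iff_map_eq_zero _).mpr fun v hv => ?_
    obtain ⟨s, u⟩ := v
    have hv' : D (s, u) = 0 := hv
    obtain rfl : s = 0 := by simpa [hv'] using (hfst (s, u)).symm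
    rw [← hv', hsnd]
  exact ⟨(LinearEquiv.ofInjectiveEndo _ hinj).toContinuousLinearEquiv, by ext <;> rfl⟩

/-! ### Systems, companion systems and scalar equations. -/

section Solutions

variable {𝕂 : Type*} [RCLike 𝕂] {m : ℕ}

theorem companionField_apply_of_lt (p : 𝕂 × (Fin m → 𝕂) → 𝕂) (w : 𝕂 × (Fin m → 𝕂)) {j : Fin m}
    (h : (j : ℕ) + 1 < m) : companionField p w j = w.2 ⟨j + 1, h⟩ := dif_pos h

theorem companionField_apply_of_not_lt (p : 𝕂 × (Fin m → 𝕂) → 𝕂) (w : 𝕂 × (Fin m → 𝕂))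
    {j : Fin m} (h : ¬ (j : ℕ) + 1 < m) : companionField p w j = p w := dif_neg h

/-- A differentiable change of coordinates which preserves time carries the solutions of a system
to solutions of the transformed system. -/
theorem IsSystemSolutionOn.map {V V' : Set (𝕂 × (Fin m → 𝕂))}
    {q q' : 𝕂 × (Fin m → 𝕂) → (Fin m → 𝕂)} {I : Set 𝕂} {z : 𝕂 → (Fin m → 𝕂)}
    (hz : IsSystemSolutionOn V q I z) {f : 𝕂 × (Fin m → 𝕂) → 𝕂 × (Fin m → 𝕂)}
    (hf : ∀ w ∈ V, DifferentiableAt 𝕂 f w) (hmaps : Set.MapsTo f V V')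
    (hfst : ∀ w ∈ V, (f w).1 = w.1)
    (hpush : ∀ w ∈ V, fderiv 𝕂 f w (1, q w) = (1, q' (f w))) :
    IsSystemSolutionOn V' q' I (fun t => (f (t, z t)).2) := by
  intro t ht
  obtain ⟨hV, hd⟩ := hz t ht
  have hft : (t, (f (t, z t)).2) = f (t, z t) := Prod.ext (hfst _ hV).symm rfl
  refine ⟨hft ▸ hmaps hV, ?_⟩
  have h := (hf _ hV).hasFDerivAt.comp_hasDerivAt t ((hasDerivAt_id t).prodMk hd)
  rw [hpush _ hV] at h
  have h' := (ContinuousLinearMap.snd 𝕂 𝕂 (Fin m → 𝕂)).hasFDerivAt.comp_hasDerivAt t h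
  beta_reduce
  rw [hft]
  exact h'

theorem IsSystemSolutionOn.congr {V : Set (𝕂 × (Fin m → 𝕂))}
    {q : 𝕂 × (Fin m → 𝕂) → (Fin m → 𝕂)} {I : Set 𝕂} (hI : IsOpen I) {z z' : 𝕂 → (Fin m → 𝕂)}
    (hz : IsSystemSolutionOn V q I z) (h : Set.EqOn z' z I) : IsSystemSolutionOn V q I z' := by
  intro t ht
  rw [h ht]
  exact ⟨(hz t ht).1, (hz t ht).2.congr_of_eventuallyEq
    (Filter.eventuallyEq_of_mem (hI.mem_nhds ht) h)⟩

variable {V : Set (𝕂 × (Fin m → 𝕂))} {p : 𝕂 × (Fin m → 𝕂) → 𝕂} {I : Set 𝕂}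

theorem IsSystemSolutionOn.iteratedDeriv_eq (hm : 0 < m) (hI : IsOpen I) {x : 𝕂 → (Fin m → 𝕂)}
    (hx : IsSystemSolutionOn V (companionField p) I x) (k : ℕ) (hk : k < m) :
    Set.EqOn (iteratedDeriv k (fun t => x t ⟨0, hm⟩)) (fun t => x t ⟨k, hk⟩) I := by
  induction k with
  | zero => intro t _; simp
  | succ k ih =>
    intro t ht
    rw [iteratedDeriv_succ, (Filter.eventuallyEq_of_mem (hI.mem_nhds ht)
      (ih (by omega))).deriv_eq, (hasDerivAt_pi.mp (hx t ht).2 ⟨k, by omega⟩).deriv,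
      companionField_apply_of_lt p _ hk]

theorem IsSystemSolutionOn.jetTuple_eq (hm : 0 < m) (hI : IsOpen I) {x : 𝕂 → (Fin m → 𝕂)}
    (hx : IsSystemSolutionOn V (companionField p) I x) {t : 𝕂} (ht : t ∈ I) :
    jetTuple m (fun t => x t ⟨0, hm⟩) t = x t :=
  funext fun k => hx.iteratedDeriv_eq hm hI k k.2 ht

/-- The first component of a solution of the companion system solves the scalar equation. -/
theorem IsSystemSolutionOn.isScalarSolutionOn (hm : 0 < m) (hI : IsOpen I)
    {x : 𝕂 → (Fin m → 𝕂)} (hx : IsSystemSolutionOn V (companionField p) I x) :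
    IsScalarSolutionOn V p I (fun t => x t ⟨0, hm⟩) := by
  intro t ht
  have hev (k : ℕ) (hk : k < m) :=
    Filter.eventuallyEq_of_mem (hI.mem_nhds ht) (hx.iteratedDeriv_eq hm hI k hk)
  have hd (k : ℕ) (hk : k < m) := hasDerivAt_pi.mp (hx t ht).2 ⟨k, hk⟩
  rw [hx.jetTuple_eq hm hI ht]
  refine ⟨(hx t ht).1, fun k hk => ?_, ?_⟩
  · exact ((hd k hk).congr_of_eventuallyEq (hev k hk)).differentiableAt
  · obtain ⟨k, rfl⟩ := Nat.exists_eq_succ_of_ne_zero hm.ne'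
    rw [iteratedDeriv_succ, (hev k k.lt_succ_self).deriv_eq,
      (hd k k.lt_succ_self).deriv, companionField_apply_of_not_lt p _ (by simp)]

/-- The jet of a solution of the scalar equation solves the companion system. -/
theorem IsScalarSolutionOn.isSystemSolutionOn {y : 𝕂 → 𝕂} (hy : IsScalarSolutionOn V p I y) :
    IsSystemSolutionOn V (companionField p) I (jetTuple m y) := by
  intro t ht
  obtain ⟨hV, hd, he⟩ := hy t ht
  refine ⟨hV, hasDerivAt_pi.mpr fun j => ?_⟩
  have h := (hd j j.2).hasDerivAt
  rw [← iteratedDeriv_succ] at h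
  by_cases hj : (j : ℕ) + 1 < m
  · rwa [companionField_apply_of_lt p _ hj]
  · rw [show (j : ℕ) + 1 = m by omega, he] at h
    rwa [companionField_apply_of_not_lt p _ hj]

end Solutions

/-! ### Construction of the coordinates and the main theorem. -/

/-- Near any point there are analytic time-preserving coordinates which bring the vector field
`(1, q)` into companion form. -/
theorem exists_companion_coordinates {𝕂 : Type*} [RCLike 𝕂] {m : ℕ}
    {U : Set (𝕂 × (Fin m → 𝕂))} (hU : IsOpen U)
    {q : 𝕂 × (Fin m → 𝕂) → (Fin m → 𝕂)} (hq : AnalyticOnNhd 𝕂 q U)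
    {a : 𝕂 × (Fin m → 𝕂)} (ha : a ∈ U) :
    ∃ (Φ : OpenPartialHomeomorph (𝕂 × (Fin m → 𝕂)) (𝕂 × (Fin m → 𝕂)))
      (p : 𝕂 × (Fin m → 𝕂) → 𝕂),
      a ∈ Φ.source ∧ Φ.source ⊆ U ∧
      AnalyticOnNhd 𝕂 Φ Φ.source ∧ AnalyticOnNhd 𝕂 Φ.symm Φ.target ∧
      (∀ w ∈ Φ.source, (Φ w).1 = w.1) ∧
      AnalyticOnNhd 𝕂 p Φ.target ∧
      (∀ w ∈ Φ.source, fderiv 𝕂 Φ w (1, q w) = (1, companionField p (Φ w))) := by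
  obtain ⟨h, hh, hslice⟩ := exists_iterate_timeLieDeriv_eq_coord hU hq a.1 m le_rfl
  have hL (j : ℕ) := hq.iterate_timeLieDeriv hh j
  let F : 𝕂 × (Fin m → 𝕂) → 𝕂 × (Fin m → 𝕂) :=
    fun w => (w.1, fun j => (timeLieDeriv q)^[j] h w)
  have hFa : AnalyticOnNhd 𝕂 F U := fun w hw =>
    analyticAt_fst.prod (analyticAt_pi_iff.mpr fun j => hL j w hw)
  have hFd (w) (hw : w ∈ U) : HasFDerivAt F ((ContinuousLinearMap.fst 𝕂 𝕂 (Fin m → 𝕂)).prod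
      (ContinuousLinearMap.pi fun j : Fin m => fderiv 𝕂 ((timeLieDeriv q)^[j] h) w)) w :=
    hasFDerivAt_fst.prodMk (hasFDerivAt_pi.mpr fun j =>
      (hL j w hw).differentiableAt.hasFDerivAt)
  obtain ⟨e, he⟩ := (fderiv 𝕂 F a).exists_equiv_of_fst_eq
    (fun v => by rw [(hFd a ha).fderiv]; rfl) fun u => by
      have hline : HasFDerivAt (fun z : Fin m → 𝕂 => F (a.1, z))
          ((fderiv 𝕂 F a).comp (ContinuousLinearMap.inr 𝕂 𝕂 (Fin m → 𝕂))) a.2 :=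
        HasFDerivAt.comp (g := F) (f := fun z => (a.1, z)) a.2
          (hFa a ha).differentiableAt.hasFDerivAt (hasFDerivAt_prodMk_right a.1 a.2)
      -- On the slice through `a` the map `F` is the identity, so its derivative fixes every `(0,
      -- u)`.
      have hev : (fun z : Fin m → 𝕂 => F (a.1, z)) =ᶠ[nhds a.2] fun z => (a.1, z) := by
        have hmem : ∀ᶠ z in nhds a.2, (a.1, z) ∈ U :=
          (Continuous.prodMk_right a.1).continuousAt.eventually_mem (hU.mem_nhds ha)
        filter_upwards [hmem] with z hz
        exact Prod.ext rfl (funext fun j => hslice j j.2 z hz)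
      have := (hline.congr_of_eventuallyEq hev.symm).unique (hasFDerivAt_prodMk_right a.1 a.2)
      simpa using congrArg (fun D => D u) this
  obtain ⟨Φ, hΦ, haΦ, hsub, hsymm⟩ := hFa.exists_openPartialHomeomorph hU ha he
  refine ⟨Φ, fun w => (timeLieDeriv q)^[m] h (Φ.symm w), haΦ, hsub, ?_, hsymm, ?_, ?_, ?_⟩
  · exact hΦ ▸ hFa.mono hsub
  · exact fun w _ => by rw [hΦ]
  · exact (hL m).comp hsymm fun w hw => hsub (Φ.map_target hw)
  · intro w hw
    have hp : Φ.symm (F w) = w := hΦ ▸ Φ.left_inv hw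
    rw [hΦ, (hFd w (hsub hw)).fderiv]
    refine Prod.ext rfl (funext fun j => ?_)
    have hsucc : fderiv 𝕂 ((timeLieDeriv q)^[j] h) w (1, q w) =
        (timeLieDeriv q)^[(j : ℕ) + 1] h w := by
      rw [Function.iterate_succ_apply']; rfl
    refine hsucc.trans ?_
    change _ = companionField (fun w => (timeLieDeriv q)^[m] h (Φ.symm w)) (F w) j
    by_cases hj : (j : ℕ) + 1 < m
    · rw [companionField_apply_of_lt _ _ hj]
    · rw [companionField_apply_of_not_lt _ _ hj, hp, show (j : ℕ) + 1 = m by omega]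

/-- Differentiate `Φ.symm ∘ Φ = id` at `Φ.symm w`. This turns the push-forward identity for `Φ` into
the one for its inverse. -/
theorem OpenPartialHomeomorph.fderiv_symm_apply_of_fderiv_apply_eq {𝕂 E F : Type*}
    [RCLike 𝕂] [NormedAddCommGroup E] [NormedSpace 𝕂 E] [NormedAddCommGroup F] [NormedSpace 𝕂 F]
    (Φ : OpenPartialHomeomorph E F) {w : F} (hw : w ∈ Φ.target)
    (h : DifferentiableAt 𝕂 Φ (Φ.symm w)) (h' : DifferentiableAt 𝕂 Φ.symm w) {u : E} {v : F}
    (huv : fderiv 𝕂 Φ (Φ.symm w) u = v) : fderiv 𝕂 Φ.symm w v = u := by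
  have hw' : Φ (Φ.symm w) = w := Φ.right_inv hw
  have hcomp := (hw'.symm ▸ h' : DifferentiableAt 𝕂 Φ.symm (Φ (Φ.symm w))).hasFDerivAt.comp _
    h.hasFDerivAt
  have hid : Φ.symm ∘ Φ =ᶠ[nhds (Φ.symm w)] id := Φ.eventually_left_inverse (Φ.map_target hw)
  have := (hcomp.congr_of_eventuallyEq hid.symm).unique (hasFDerivAt_id _)
  rw [hw'] at this
  rw [← huv]
  exact congrArg (fun D => D u) this

theorem mainTheorem6 {𝕂 : Type*} [RCLike 𝕂] (m : ℕ) (hm : 0 < m)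
    (U : Set (𝕂 × (Fin m → 𝕂))) (hU : IsOpen U)
    (q : 𝕂 × (Fin m → 𝕂) → (Fin m → 𝕂)) (hq : AnalyticOnNhd 𝕂 q U)
    (tstar : 𝕂) (zstar : Fin m → 𝕂) (hmem : (tstar, zstar) ∈ U)
    (hne : q (tstar, zstar) ≠ 0) :
    ∃ (Φ : OpenPartialHomeomorph (𝕂 × (Fin m → 𝕂)) (𝕂 × (Fin m → 𝕂)))
      (p : 𝕂 × (Fin m → 𝕂) → 𝕂),
      -- `Φ : (t, z) ↦ (t, x)` is an analytic change of coordinates near the given point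
      (tstar, zstar) ∈ Φ.source ∧ Φ.source ⊆ U ∧
      AnalyticOnNhd 𝕂 Φ Φ.source ∧ AnalyticOnNhd 𝕂 Φ.symm Φ.target ∧
      (∀ w ∈ Φ.source, (Φ w).1 = w.1) ∧
      AnalyticOnNhd 𝕂 p Φ.target ∧
      -- `Φ` carries the vector field `(1, q)` to `(1, x₂, …, xₘ, p)`
      (∀ w ∈ Φ.source, fderiv 𝕂 Φ w (1, q w) = (1, companionField p (Φ w))) ∧
      ∀ I : Set 𝕂, IsOpen I →
        -- solutions of the given system correspond to solutions of the companion system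
        (∀ z : 𝕂 → (Fin m → 𝕂), (∀ t ∈ I, (t, z t) ∈ Φ.source) →
          (IsSystemSolutionOn Φ.source q I z ↔
            IsSystemSolutionOn Φ.target (companionField p) I (fun t => (Φ (t, z t)).2))) ∧
        -- solutions of the given system correspond to solutions of the equation of order `m`
        (∀ z : 𝕂 → (Fin m → 𝕂), IsSystemSolutionOn Φ.source q I z →
          IsScalarSolutionOn Φ.target p I (fun t => (Φ (t, z t)).2 ⟨0, hm⟩) ∧
          ∀ t ∈ I, Φ (t, z t) = (t, jetTuple m (fun s => (Φ (s, z s)).2 ⟨0, hm⟩) t)) ∧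
        (∀ y : 𝕂 → 𝕂, IsScalarSolutionOn Φ.target p I y →
          IsSystemSolutionOn Φ.source q I (fun t => (Φ.symm (t, jetTuple m y t)).2) ∧
          ∀ t ∈ I, Φ (t, (Φ.symm (t, jetTuple m y t)).2) = (t, jetTuple m y t)) := by
  obtain ⟨Φ, p, ha, hsub, hΦ, hΦs, hfst, hp, hpush⟩ := exists_companion_coordinates hU hq hmem
  have hfst' : ∀ w ∈ Φ.target, (Φ.symm w).1 = w.1 := fun w hw => by
    rw [← hfst _ (Φ.map_target hw), Φ.right_inv hw]
  have hpush' : ∀ w ∈ Φ.target, fderiv 𝕂 Φ.symm w (1, companionField p w) =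
      (1, q (Φ.symm w)) := fun w hw => by
    refine Φ.fderiv_symm_apply_of_fderiv_apply_eq hw
      (hΦ _ (Φ.map_target hw)).differentiableAt (hΦs w hw).differentiableAt ?_
    rw [hpush _ (Φ.map_target hw), Φ.right_inv hw]
  have hto {I : Set 𝕂} {z : 𝕂 → (Fin m → 𝕂)} (hz : IsSystemSolutionOn Φ.source q I z) :
      IsSystemSolutionOn Φ.target (companionField p) I (fun t => (Φ (t, z t)).2) :=
    hz.map (fun w hw => (hΦ w hw).differentiableAt) (fun _ => Φ.map_source) hfst hpush
  have hfrom {I : Set 𝕂} {x : 𝕂 → (Fin m → 𝕂)}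
      (hx : IsSystemSolutionOn Φ.target (companionField p) I x) :
      IsSystemSolutionOn Φ.source q I (fun t => (Φ.symm (t, x t)).2) :=
    hx.map (fun w hw => (hΦs w hw).differentiableAt) (fun _ => Φ.map_target) hfst' hpush'
  refine ⟨Φ, p, ha, hsub, hΦ, hΦs, hfst, hp, hpush, fun I hI => ⟨fun z hz => ⟨hto, fun hx => ?_⟩,
    fun z hz => ⟨(hto hz).isScalarSolutionOn hm hI, fun t ht => ?_⟩, fun y hy =>
    ⟨hfrom hy.isSystemSolutionOn, fun t ht => ?_⟩⟩⟩
  -- Mapping back by `Φ.symm` recovers `z` only on `I`; as `I` is open, this suffices for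
  -- derivatives.
  · refine (hfrom hx).congr hI fun t ht => ?_
    have : (t, (Φ (t, z t)).2) = Φ (t, z t) := Prod.ext (hfst _ (hz t ht)).symm rfl
    simp only [this, Φ.left_inv (hz t ht)]
  · rw [(hto hz).jetTuple_eq hm hI ht]
    exact Prod.ext (hfst _ (hz t ht).1) rfl
  · have hV := (hy t ht).1
    have : (t, (Φ.symm (t, jetTuple m y t)).2) = Φ.symm (t, jetTuple m y t) :=
      Prod.ext (hfst' _ hV).symm rfl
    rw [this, Φ.right_inv hV]
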